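/- Let $X$ be a real Hilbert space with dual $X^*$, let $f\colon X\to(-\infty,\infty]$ be proper and convex, and let $g\colon X\to[-\infty,\infty)$ be proper and concave (that is, $-g$ is proper and convex). Put $\operatorname{dom} f=\{x: f(x)<\infty\}$, $\operatorname{dom} g=\{x: g(x)>-\infty\}$, $\operatorname{epi} f=\{(x,\alpha)\in X\times\mathbb R: \alpha\ge f(x)\}$, $\operatorname{hypo} g=\{(x,\alpha)\in X\times\mathbb R: \alpha\le g(x)\}$, and, for $x^*\in X^*$, $$f^*(x^*)=\sup_{x\in X}\{\langle x^*,x\rangle-f(x)\},\qquad g_*(x^*)=\inf_{x\in X}\{\langle x^*,x\rangle-g(x)\}.$$ For a convex set $\Omega$ in a normed space $E$ let $\operatorname{cone} S=\{tw: t\ge 0,\ w\in S\}$, $$\operatorname{iri}\Omega=\{x\in\Omega: \operatorname{cone}(\Omega-x)\text{ is a linear subspace}\},\qquad \operatorname{qri}\Omega=\{x\in\Omega: \overline{\operatorname{cone}}(\Omega-x)\text{ is a linear subspace}\},$$ and $N(x;\Omega)=\{x^*\in E^*: \langle x^*,y-x\rangle\le 0\ \ \forall y\in\Omega\}$ for $x\in\Omega$.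 Call $\Omega$ sequentially normally compact (SNC) if for every $\bar x\in\Omega$ and all sequences $x_k\in\Omega$, $x_k^*\in N(x_k;\Omega)$ with $x_k\to\bar x$ and $x_k^*\to 0$ in the weak$^*$ topology one has $\|x_k^*\|\to 0$. Suppose that each of the sets $\operatorname{dom} f-\operatorname{dom} g\subset X$, $\operatorname{epi} f\subset X\times\mathbb R$ and $\operatorname{epi} f-\operatorname{hypo} g\subset X\times\mathbb R$ is closed, SNC, and has nonempty intrinsic relative interior (iri), and that $\operatorname{qri}(\operatorname{dom} f)\cap\operatorname{qri}(\operatorname{dom} g)\ne\emptyset$. Then Fenchel duality holds: $$\inf\{f(x)-g(x): x\in X\}=\sup\{g_*(x^*)-f^*(x^*): x^*\in X^*\}$$ as an equality in $[-\infty,\infty]$. -/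

import Mathlib

open Filter Topology
open scoped Pointwise

namespace FenchelDuality

section Sets

variable {E : Type*} [AddCommGroup E] [Module ℝ E]

/-- The cone generated by a set: all `t • w` with `t ≥ 0` and `w ∈ S`. -/
def cone (S : Set E) : Set E :=
  {v | ∃ t : ℝ, 0 ≤ t ∧ ∃ w ∈ S, v = t • w}

/-- The set `S` is (the carrier of) a linear subspace. -/
def IsSubspace (S : Set E) : Prop :=
  ∃ L : Submodule ℝ E, (L : Set E) = S

/-- Intrinsic relative interior of a (convex) set. -/
def iri (Ω : Set E) : Set E :=
  {x | x ∈ Ω ∧ IsSubspace (cone (Ω - {x}))}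

/-- Quasi-relative interior of a (convex) set. -/
def qri [TopologicalSpace E] (Ω : Set E) : Set E :=
  {x | x ∈ Ω ∧ IsSubspace (closure (cone (Ω - {x})))}

end Sets

section Normed

variable {E : Type*} [NormedAddCommGroup E] [NormedSpace ℝ E]

/-- The normal cone to a (convex) set at `x`; it is only used at points `x ∈ Ω`. -/
def normalCone (Ω : Set E) (x : E) : Set (StrongDual ℝ E) :=
  {φ | ∀ y ∈ Ω, φ (y - x) ≤ 0}

/-- Sequential normal compactness of `Ω` at `a`: weak-star null sequences of normals taken at points
of `Ω` converging to `a` are norm null. -/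
def SNCAt (Ω : Set E) (a : E) : Prop :=
  ∀ (x : ℕ → E) (φ : ℕ → StrongDual ℝ E),
    (∀ k, x k ∈ Ω) → (∀ k, φ k ∈ normalCone Ω (x k)) →
    Tendsto x atTop (𝓝 a) →
    Tendsto (fun k => StrongDual.toWeakDual (φ k)) atTop (𝓝 0) →
    Tendsto (fun k => ‖φ k‖) atTop (𝓝 0)

/-- `Ω` is sequentially normally compact at each of its points. -/
def SNC (Ω : Set E) : Prop :=
  ∀ a ∈ Ω, SNCAt Ω a

end Normed

section Functions

variable {X : Type*}

/-- Effective domain of a function with values in `(-∞, ∞]`. -/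
def dom (f : X → EReal) : Set X := {x | f x < ⊤}

/-- Effective domain of a function with values in `[-∞, ∞)` (it is the domain of `-g`). -/
def domConcave (g : X → EReal) : Set X := {x | ⊥ < g x}

/-- Epigraph. -/
def epi (f : X → EReal) : Set (X × ℝ) := {p | f p.1 ≤ (p.2 : EReal)}

/-- Hypograph. -/
def hypo (g : X → EReal) : Set (X × ℝ) := {p | (p.2 : EReal) ≤ g p.1}

/-- `f : X → (-∞, ∞]` is convex and proper. -/
structure IsProperConvex [AddCommGroup X] [Module ℝ X] (f : X → EReal) : Prop where
  ne_bot : ∀ x, f x ≠ ⊥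
  nonempty_dom : (dom f).Nonempty
  convex_epi : Convex ℝ (epi f)

/-- `g : X → [-∞, ∞)` is concave and proper, that is, `-g` is convex and proper. -/
def IsProperConcave [AddCommGroup X] [Module ℝ X] (g : X → EReal) : Prop :=
  IsProperConvex (fun x => -g x)

variable [NormedAddCommGroup X] [NormedSpace ℝ X]

/-- Convex Fenchel conjugate `f^*`. -/
noncomputable def convexConj (f : X → EReal) (φ : StrongDual ℝ X) : EReal :=
  ⨆ x : X, (((φ x : ℝ) : EReal) - f x)

/-- Concave Fenchel conjugate `g_*`. -/
noncomputable def concaveConj (g : X → EReal) (φ : StrongDual ℝ X) : EReal :=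
  ⨅ x : X, (((φ x : ℝ) : EReal) - g x)

end Functions

end FenchelDuality

open FenchelDuality

namespace FenchelDuality

/-! Weak duality is pointwise. For the converse, let `r` be a real number below the primal infimum.
Then `(0, r)` lies outside the closed convex set `epi f - hypo g`, so Hahn–Banach separates them
strictly by some `(ψ, s)`. A common point of the domains forces `s > 0`: the hyperplane is not
vertical. Then `-ψ / s` has dual value at least `r`. -/

theorem IsProperConcave.ne_top {X : Type*} [AddCommGroup X] [Module ℝ X] {g : X → EReal}
    (hg : IsProperConcave g) (x : X) : g x ≠ ⊤ := by
  intro h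
  exact IsProperConvex.ne_bot hg x (by simp [h])

theorem IsProperConcave.convex_hypo {X : Type*} [AddCommGroup X] [Module ℝ X] {g : X → EReal}
    (hg : IsProperConcave g) : Convex ℝ (hypo g) := by
  have h : hypo g = (LinearMap.prodMap LinearMap.id (-LinearMap.id) : X × ℝ →ₗ[ℝ] X × ℝ) ⁻¹'
      epi (fun x => -g x) := by
    ext p
    simp [hypo, epi]
  rw [h]
  exact (IsProperConvex.convex_epi hg).linear_preimage _

section Duality

variable {X : Type*} [NormedAddCommGroup X] [NormedSpace ℝ X] {f g : X → EReal}

/-- Weak Fenchel duality. -/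
theorem concaveConj_sub_convexConj_le (hf : ∀ x, f x ≠ ⊥) (hg : ∀ x, g x ≠ ⊤)
    (φ : StrongDual ℝ X) (x : X) : concaveConj g φ - convexConj f φ ≤ f x - g x := by
  have h₁ : concaveConj g φ ≤ ((φ x : ℝ) : EReal) - g x := iInf_le _ x
  have h₂ : ((φ x : ℝ) : EReal) - f x ≤ convexConj f φ :=
    le_iSup (fun x => ((φ x : ℝ) : EReal) - f x) x
  refine (EReal.sub_le_sub h₁ h₂).trans ?_
  have hfx := hf x
  have hgx := hg x
  generalize f x = a at *
  generalize g x = b at *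
  induction a with
  | bot => exact absurd rfl hfx
  | top =>
    rw [EReal.top_sub hgx]
    exact le_top
  | coe a =>
    induction b with
    | top => exact absurd rfl hgx
    | bot => simp
    | coe b =>
      norm_cast
      linarith

/-- An affine minorant of the marginal function gives a lower bound for the dual value. -/
theorem le_concaveConj_sub_convexConj {φ : StrongDual ℝ X} {r : ℝ}
    (hf : (dom f).Nonempty) (hf' : ∀ x, f x ≠ ⊥) (hg : (domConcave g).Nonempty)
    (hg' : ∀ x, g x ≠ ⊤)
    (h : ∀ x y : X, ∀ a b : ℝ, f x ≤ a → b ≤ g y → φ x - a + r ≤ φ y - b) :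
    (r : EReal) ≤ concaveConj g φ - convexConj f φ := by
  have key : ∀ y, ∀ b : ℝ, b ≤ g y → convexConj f φ ≤ ((φ y - b - r : ℝ) : EReal) := by
    intro y b hb
    refine iSup_le fun x => ?_
    have hfx := hf' x
    have hx := fun a => h x y a b
    generalize f x = a at *
    induction a with
    | bot => exact absurd rfl hfx
    | top => simp
    | coe a =>
      have := hx a le_rfl hb
      norm_cast
      linarith
  obtain ⟨x₀, hx₀⟩ := hf
  obtain ⟨y₀, hy₀⟩ := hg
  have hlow : ((φ x₀ : ℝ) : EReal) - f x₀ ≤ convexConj f φ :=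
    le_iSup (fun x => ((φ x : ℝ) : EReal) - f x) x₀
  have hup := key y₀ (g y₀).toReal (EReal.coe_toReal_le hy₀.ne')
  have hfx₀ : f x₀ = ((f x₀).toReal : EReal) := (EReal.coe_toReal hx₀.ne (hf' x₀)).symm
  rw [hfx₀] at hlow
  -- The conjugate is finite: `x₀` bounds it below and `y₀` above, so the subtraction can be moved
  -- across the inequality.
  generalize convexConj f φ = c at *
  induction c with
  | bot => simp [← EReal.coe_sub] at hlow
  | top => exact absurd (top_le_iff.1 hup) (EReal.coe_ne_top _)
  | coe c =>
    rw [EReal.le_sub_iff_add_le (by simp) (by simp)]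
    refine le_iInf fun y => ?_
    have hgy := hg' y
    have hy := fun b => key y b
    generalize g y = b at *
    induction b with
    | top => exact absurd rfl hgy
    | bot => simp
    | coe b =>
      have := hy b le_rfl
      norm_cast at this ⊢
      linarith

/-- Strong Fenchel duality when the difference of the epigraph and the hypograph is closed and the
effective domains meet. -/
theorem iInf_sub_eq_iSup_conj (hf : IsProperConvex f) (hg : IsProperConcave g)
    (hclosed : IsClosed (epi f - hypo g)) (hdom : (dom f ∩ domConcave g).Nonempty) :
    (⨅ x : X, (f x - g x)) = ⨆ φ : StrongDual ℝ X, (concaveConj g φ - convexConj f φ) := by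
  refine le_antisymm (EReal.ge_of_forall_gt_iff_ge.1 fun r hr => ?_)
    (iSup_le fun φ => le_iInf fun x =>
      concaveConj_sub_convexConj_le hf.ne_bot hg.ne_top φ x)
  obtain ⟨x₀, hfx₀, hgx₀⟩ := hdom
  have hr' : ((0 : X), r) ∉ epi f - hypo g := by
    rintro ⟨⟨x, a⟩, ha, ⟨y, b⟩, hb, hab⟩
    obtain ⟨hxy, rfl⟩ := Prod.mk.inj hab
    obtain rfl := sub_eq_zero.1 hxy
    have hle : f x - g x ≤ ((a - b : ℝ) : EReal) := EReal.sub_le_sub ha hb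
    exact absurd (hr.trans_le ((iInf_le _ x).trans hle)) (lt_irrefl _)
  obtain ⟨Φ, u, hu, hΦ⟩ := geometric_hahn_banach_point_closed
    (hf.convex_epi.sub hg.convex_hypo) hclosed hr'
  set ψ : StrongDual ℝ X := Φ.comp (ContinuousLinearMap.inl ℝ X ℝ)
  set s : ℝ := Φ (0, 1)
  have hΦ_apply (z : X) (t : ℝ) : Φ (z, t) = ψ z + t * s := by
    have : ((z, t) : X × ℝ) = (z, 0) + t • ((0 : X), (1 : ℝ)) := by simp
    rw [this, map_add, map_smul]
    rfl
  have hsep (x y : X) (a b : ℝ) (ha : f x ≤ a) (hb : b ≤ g y) :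
      r * s < ψ x - ψ y + (a - b) * s := by
    have h := hu.trans (hΦ ((x, a) - (y, b)) (Set.sub_mem_sub ha hb))
    rw [Prod.mk_sub_mk, hΦ_apply, hΦ_apply, map_zero, zero_add, map_sub] at h
    exact h
  -- Taking both points equal to `x₀` cancels `ψ` and leaves `r * s < (a - b) * s`, while `r < a -
  -- b`.
  have hs_pos : 0 < s := by
    have hle : ((r : ℝ) : EReal) < f x₀ - g x₀ := hr.trans_le (iInf_le _ x₀)
    lift f x₀ to ℝ using ⟨hfx₀.ne, hf.ne_bot x₀⟩ with a ha
    lift g x₀ to ℝ using ⟨hg.ne_top x₀, hgx₀.ne'⟩ with b hb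
    have h := hsep x₀ x₀ a b ha.ge hb.le
    norm_cast at hle
    nlinarith
  -- Dividing the separation by `s` gives an affine minorant of slope `ψ / s` in `x - y`; the minus
  -- sign matches the form `φ x - a + r ≤ φ y - b`.
  refine le_trans ?_ (le_iSup _ (-(s⁻¹ • ψ)))
  refine le_concaveConj_sub_convexConj ⟨x₀, hfx₀⟩ hf.ne_bot ⟨x₀, hgx₀⟩ hg.ne_top
    fun x y a b ha hb => ?_
  have h := hsep x y a b ha hb
  have h' : r < (ψ x - ψ y) * s⁻¹ + (a - b) := by
    rw [← mul_lt_mul_iff_left₀ hs_pos, add_mul, inv_mul_cancel_right₀ hs_pos.ne']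
    exact h
  simp only [neg_apply, smul_apply, smul_eq_mul]
  linarith

end Duality

end FenchelDuality

open FenchelDuality
theorem corollary4p7 {X : Type*} [NormedAddCommGroup X] [InnerProductSpace ℝ X] [CompleteSpace X]
    (f g : X → EReal) (hf : IsProperConvex f) (hg : IsProperConcave g)
    (hdom_closed : IsClosed (dom f - domConcave g))
    (hdom_snc : SNC (dom f - domConcave g))
    (hdom_iri : (iri (dom f - domConcave g)).Nonempty)
    (hepi_closed : IsClosed (epi f))
    (hepi_snc : SNC (epi f))
    (hepi_iri : (iri (epi f)).Nonempty)
    (hdiff_closed : IsClosed (epi f - hypo g))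
    (hdiff_snc : SNC (epi f - hypo g))
    (hdiff_iri : (iri (epi f - hypo g)).Nonempty)
    (hqri : (qri (dom f) ∩ qri (domConcave g)).Nonempty) :
    (⨅ x : X, (f x - g x)) = ⨆ φ : StrongDual ℝ X, (concaveConj g φ - convexConj f φ) := by
  obtain ⟨x, hfx, hgx⟩ := hqri
  exact iInf_sub_eq_iSup_conj hf hg hdiff_closed ⟨x, hfx.1, hgx.1⟩
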